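/- **Lemma (convergence of dual averaging).** Let $N=\{1,\dots,n\}$ be the agents and $M=\{1,\dots,m\}$ the item types, let $B_i>0$ with $\sum_{i\in N}B_i=1$, let $s=(s_j)_{j\in M}$ be a probability vector, and let $v^{DA}=(v^{DA}_{i,j})$ be a fixed matrix of nonnegative values. Let $l>0$ and $h$ be such that $l\le\sum_{j\in M}s_jv^{DA}_{i,j}\le h$ for every $i\in N$, and let $\delta_0>0$ be arbitrary. Run dual averaging for $T\ge1$ rounds: put $\bar u^{DA}(0)=0$, and in each round $t=1,\dots,T$ 1. an item of type $j(t)$ arrives, where $j(1),\dots,j(T)$ are i.i.d. with distribution $s$; 2. each agent has the multiplier $\beta_i=\max\bigl(\tfrac{B_i}{h(1+\delta_0)},\min\bigl(\tfrac{1+\delta_0}{l},\tfrac{B_i}{\bar u^{DA}_i(t-1)}\bigr)\bigr)$, where $B_i/0=+\infty$; 3. the item goes to an agent $i(t)\in\arg\max_{i}\beta_iv^{DA}_{i,j(t)}$, ties being broken arbitrarily (possibly at random and depending on the past and on $j(t)$, but not anticipating: $j(t)$ is independent of $(j(\tau),i(\tau))_{\tau<t}$); 4. $\bar u^{DA}_i(t)=\tfrac{t-1}{t}\,\bar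 u^{DA}_i(t-1)+\tfrac1t\,\mathbb 1\{i=i(t)\}\,v^{DA}_{i,j(t)}$. So $\bar u^{DA}(T)$ is the mean utility vector at the end of round $T$. Let $u^{*,DA}_i=\sum_{j}s_jv^{DA}_{i,j}x^*_{i,j}$, where $x^*$ is an optimal solution of the Eisenberg–Gale program: maximize $\prod_{i\in N}\bigl(\sum_{j\in M}s_jv^{DA}_{i,j}x_{i,j}\bigr)^{B_i}$ over $x\ge0$ with $\sum_{i\in N}x_{i,j}\le1$ for every $j\in M$. Then $\|\bar u^{DA}(T)-u^{*,DA}\|^2$ (Euclidean norm) is integrable, and $$\mathbb E\left[\|\bar u^{DA}(T)-u^{*,DA}\|^2\right]\le C^{DA}\,\frac{6+\log T}{T},$$ where $$C^{DA}=\frac{\|v^{DA}\|_\infty^2(1+\delta_0)^6}{l^4(\min_{i\in N}B_i)^4}\left(\frac{h^3\|v^{DA}\|_\infty^2}{l}\Bigl(\frac1{\delta_0}\Bigr)^2+h^4\right),\qquad \|v^{DA}\|_\infty=\max_{i,j}|v^{DA}_{i,j}| .$$ -/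

import Mathlib

open MeasureTheory ProbabilityTheory

noncomputable section

namespace OnlineFairDivision

/-! ### The Eisenberg-Gale program -/

/-- Expected per-item utility of agent `i` under the fractional allocation `x`,
for item-type distribution `s` and value matrix `v`. -/
def allocUtility {n m : ℕ} (s : Fin m → ℝ) (v : Fin n → Fin m → ℝ)
    (x : Fin n → Fin m → ℝ) (i : Fin n) : ℝ :=
  ∑ j, s j * v i j * x i j

/-- Feasible fractional allocations: `x i j ≥ 0`, and no item type is over-allocated. -/
def IsFeasible {n m : ℕ} (x : Fin n → Fin m → ℝ) : Prop :=
  (∀ i j, 0 ≤ x i j) ∧ ∀ j, ∑ i, x i j ≤ 1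

/-- Weighted Nash social welfare of a fractional allocation. -/
def nashWelfare {n m : ℕ} (B : Fin n → ℝ) (s : Fin m → ℝ) (v : Fin n → Fin m → ℝ)
    (x : Fin n → Fin m → ℝ) : ℝ :=
  ∏ i, allocUtility s v x i ^ B i

/-- `x` is an optimal solution of the Eisenberg-Gale program. -/
def IsEGOptimal {n m : ℕ} (B : Fin n → ℝ) (s : Fin m → ℝ) (v : Fin n → Fin m → ℝ)
    (x : Fin n → Fin m → ℝ) : Prop :=
  IsFeasible x ∧ ∀ y, IsFeasible y → nashWelfare B s v y ≤ nashWelfare B s v x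

/-- `u` is the utility vector of an optimal solution of the Eisenberg-Gale program. -/
def IsEGUtility {n m : ℕ} (B : Fin n → ℝ) (s : Fin m → ℝ) (v : Fin n → Fin m → ℝ)
    (u : Fin n → ℝ) : Prop :=
  ∃ x, IsEGOptimal B s v x ∧ u = allocUtility s v x

/-! ### Dual averaging -/

/-- The multiplier `Proj_{[b/(h(1+δ₀)), (1+δ₀)/l]} (b / u)` of an agent with budget `b` and mean
utility `u ≥ 0`, where `Proj_{[a,c]} y = max a (min c y)`.
Here `b / 0 = +∞`, so that `min c (b / 0) = c`. -/
def daMultiplier (l h δ₀ b u : ℝ) : ℝ :=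
  max (b / (h * (1 + δ₀)))
    (if u = 0 then (1 + δ₀) / l else min ((1 + δ₀) / l) (b / u))

/-- The mean utilities after `t` rounds, when the round with index `k = 0, 1, …` (the `(k+1)`-st
round) brings an item of type `item k`, which is given to the agent `winner k`. -/
def meanUtility {n m : ℕ} (v : Fin n → Fin m → ℝ) (item : ℕ → Fin m) (winner : ℕ → Fin n) :
    ℕ → Fin n → ℝ
  | 0 => fun _ => 0
  | t + 1 => fun i =>
      (t : ℝ) / (t + 1) * meanUtility v item winner t i
        + 1 / ((t : ℝ) + 1) * (if i = winner t then v i (item t) else 0)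

/-- A run of dual averaging for `T` rounds, with values `v`, budgets `B` and parameters
`l, h, δ₀`, on items drawn i.i.d. from `s`. Ties are broken arbitrarily, possibly depending on
the past, on the current item and on external randomness, but not on future items. -/
structure IsDARun {Ω : Type*} [MeasurableSpace Ω] (μ : Measure Ω) {n m : ℕ} (T : ℕ)
    (B : Fin n → ℝ) (s : Fin m → ℝ) (v : Fin n → Fin m → ℝ) (l h δ₀ : ℝ)
    (item : ℕ → Ω → Fin m) (winner : ℕ → Ω → Fin n) : Prop where
  measurable_item : ∀ t < T, Measurable (item t)
  measurable_winner : ∀ t < T, Measurable (winner t)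
  /-- Each item is distributed according to `s`. -/
  law_item : ∀ t < T, ∀ j, μ.real {ω | item t ω = j} = s j
  /-- The items are independent. -/
  indep_item : iIndepFun (fun t : Fin T => item t) μ
  /-- The item of a round is independent of everything that happened before that round. -/
  nonanticipating : ∀ t < T,
    IndepFun (item t) (fun ω => fun k : Fin t => (item k ω, winner k ω)) μ
  /-- The winner of a round has a maximal bid. -/
  winner_maximal : ∀ t < T, ∀ ω, ∀ i,
    let u := meanUtility v (fun k => item k ω) (fun k => winner k ω) t
    daMultiplier l h δ₀ (B i) (u i) * v i (item t ω)
      ≤ daMultiplier l h δ₀ (B (winner t ω)) (u (winner t ω)) * v (winner t ω) (item t ω)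

/-- The constant `C^DA`. The norm `‖v‖` is the sup norm, `max_{i,j} |v i j|`. -/
def daConstant {n m : ℕ} (B : Fin n → ℝ) (v : Fin n → Fin m → ℝ) (l h δ₀ : ℝ) : ℝ :=
  ‖v‖ ^ 2 * (1 + δ₀) ^ 6 / (l ^ 4 * (⨅ i, B i) ^ 4)
    * (h ^ 3 * ‖v‖ ^ 2 / l * (1 / δ₀) ^ 2 + h ^ 4)

end OnlineFairDivision

end

namespace OnlineFairDivision

/-! Each multiplier minimises `y ↦ u y - b log y` over the box `[b/(h(1+δ₀)), (1+δ₀)/l]`, with `u`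
the agent's mean past utility. The algorithm is thus dual averaging with logarithmic regulariser on
the dual of the Eisenberg–Gale program, whose solution is `w i = B i / uₛ i`, with `uₛ` the optimal
utilities. Strong convexity of the regulariser (`daMultiplier_isMin`) gives a pathwise bound
(`dualAveraging_regret`): `T` times the squared distance from the last multiplier to `w` is
controlled by the regret against `w` plus an error of order `log T`. Summed over agents, the regret
of a round has nonpositive expectation after an upper estimate: the winner's bid dominates the bids
averaged along the optimal allocation, whose expected utility is exactly `uₛ`, and the expected
highest bid at `w` is at most `1` (`IsEGOptimal.sum_mul_bid_le_one`). The multipliers therefore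
converge in mean square at rate `log T / T`, and `sq_sub_le_sq_daMultiplier_sub` transfers this to
the utilities. -/

/-! ### The regularised scalar problem solved by the multiplier -/

/-- Strong concavity of the logarithm on `(0, c]`. -/
theorem log_le_sub_sq {c p w : ℝ} (hp : 0 < p) (hw : 0 < w) (hpc : p ≤ c) (hwc : w ≤ c) :
    Real.log w ≤ Real.log p + (w - p) / p - (w - p) ^ 2 / (2 * c ^ 2) := by
  have hc : 0 < c := hp.trans_le hpc
  let G : ℝ → ℝ := fun y => Real.log y - (y - p) / p + (y - p) ^ 2 / (2 * c ^ 2)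
  have hG : ∀ y, 0 < y → HasDerivAt G (y⁻¹ - 1 / p + (2 * (y - p)) / (2 * c ^ 2)) y := by
    intro y hy
    have h1 := (Real.hasDerivAt_log hy.ne').sub (((hasDerivAt_id y).sub_const p).div_const p)
    have h2 := (((hasDerivAt_id y).sub_const p).pow 2).div_const (2 * c ^ 2)
    exact (h1.add h2).congr_deriv (by norm_num)
  have hG' : ∀ y, 0 < y → y⁻¹ - 1 / p + (2 * (y - p)) / (2 * c ^ 2)
      = (p - y) * (c ^ 2 - y * p) / (y * p * c ^ 2) := by
    intro y hy
    field_simp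
    ring
  -- Since `y p ≤ c ^ 2`, the derivative in `hG'` has the sign of `p - y`, so `G` peaks at `p`.
  have key : G w ≤ G p := by
    rcases le_total p w with h | h
    · refine antitoneOn_of_deriv_nonpos (convex_Icc p w)
        (fun y hy => (hG y (hp.trans_le hy.1)).continuousAt.continuousWithinAt)
        (fun y hy => ?_) (fun y hy => ?_) (Set.left_mem_Icc.2 h) (Set.right_mem_Icc.2 h) h
      · rw [interior_Icc] at hy
        exact (hG y (hp.trans hy.1)).differentiableAt.differentiableWithinAt
      · rw [interior_Icc] at hy
        have hy0 := hp.trans hy.1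
        rw [(hG y hy0).deriv, hG' y hy0]
        refine div_nonpos_of_nonpos_of_nonneg
          (mul_nonpos_of_nonpos_of_nonneg (by linarith [hy.1]) ?_) (by positivity)
        have := mul_le_mul (hy.2.le.trans hwc) hpc hp.le hc.le
        nlinarith
    · refine monotoneOn_of_deriv_nonneg (convex_Icc w p)
        (fun y hy => (hG y (hw.trans_le hy.1)).continuousAt.continuousWithinAt)
        (fun y hy => ?_) (fun y hy => ?_) (Set.left_mem_Icc.2 h) (Set.right_mem_Icc.2 h) h
      · rw [interior_Icc] at hy
        exact (hG y (hw.trans hy.1)).differentiableAt.differentiableWithinAt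
      · rw [interior_Icc] at hy
        have hy0 := hw.trans hy.1
        rw [(hG y hy0).deriv, hG' y hy0]
        refine div_nonneg (mul_nonneg (by linarith [hy.2]) ?_) (by positivity)
        have := mul_le_mul (hy.2.le.trans hpc) hpc hp.le hc.le
        nlinarith
  simp only [G, sub_self] at key
  norm_num at key
  linarith

theorem daMultiplier_mem {l h δ b u : ℝ} (hac : b / (h * (1 + δ)) ≤ (1 + δ) / l) :
    daMultiplier l h δ b u ∈ Set.Icc (b / (h * (1 + δ))) ((1 + δ) / l) := by
  unfold daMultiplier
  refine ⟨le_max_left _ _, max_le hac ?_⟩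
  split_ifs
  · exact le_rfl
  · exact min_le_left _ _

/-- The multiplier is either untruncated, or truncated from above, or truncated from below. -/
theorem daMultiplier_cases {l h δ b u : ℝ} (hb : 0 < b) (hu : 0 ≤ u)
    (hac : b / (h * (1 + δ)) ≤ (1 + δ) / l) :
    (0 < u ∧ daMultiplier l h δ b u = b / u) ∨
    (u * daMultiplier l h δ b u ≤ b ∧ daMultiplier l h δ b u = (1 + δ) / l) ∨
    (b ≤ u * daMultiplier l h δ b u ∧ daMultiplier l h δ b u = b / (h * (1 + δ))) := by
  unfold daMultiplier
  rcases hu.eq_or_lt with rfl | hu'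
  · right; left
    simp [hb.le, hac]
  · rw [if_neg hu'.ne']
    rcases le_total ((1 + δ) / l) (b / u) with h1 | h1
    · right; left
      rw [min_eq_left h1, max_eq_right hac]
      exact ⟨by rw [le_div_iff₀ hu'] at h1; linarith, rfl⟩
    · rw [min_eq_right h1]
      rcases le_total (b / (h * (1 + δ))) (b / u) with h2 | h2
      · left
        exact ⟨hu', max_eq_right h2⟩
      · right; right
        rw [max_eq_left h2]
        exact ⟨by rw [div_le_iff₀ hu'] at h2; linarith, rfl⟩

/-- The multiplier minimises `y ↦ u y - b log y` over its range, with quadratic growth. -/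
theorem daMultiplier_isMin {l h δ b u w : ℝ} (hl : 0 < l) (hh : 0 < h) (hδ : 0 < δ) (hb : 0 < b)
    (hu : 0 ≤ u) (hac : b / (h * (1 + δ)) ≤ (1 + δ) / l)
    (hw : w ∈ Set.Icc (b / (h * (1 + δ))) ((1 + δ) / l)) :
    u * daMultiplier l h δ b u - b * Real.log (daMultiplier l h δ b u)
      + b / ((1 + δ) / l) ^ 2 / 2 * (w - daMultiplier l h δ b u) ^ 2 ≤ u * w - b * Real.log w := by
  have hmem := daMultiplier_mem (u := u) hac
  have hcases := daMultiplier_cases hb hu hac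
  set p := daMultiplier l h δ b u
  have ha : 0 < b / (h * (1 + δ)) := by positivity
  have hc : 0 < (1 + δ) / l := by positivity
  have hp : 0 < p := ha.trans_le hmem.1
  have hlog := mul_le_mul_of_nonneg_left
    (log_le_sub_sq hp (ha.trans_le hw.1) hmem.2 hw.2) hb.le
  -- First-order condition: the derivative at `p` vanishes, or `p` is an endpoint and the objective
  -- does not decrease into the box.
  have hfirst : 0 ≤ (u - b / p) * (w - p) := by
    rcases hcases with ⟨hu', h1⟩ | ⟨h1, h2⟩ | ⟨h1, h2⟩
    · have : u - b / p = 0 := by rw [h1]; field_simp; simp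
      rw [this, zero_mul]
    · refine mul_nonneg_of_nonpos_of_nonpos ?_ (by linarith [hw.2])
      rw [sub_nonpos, le_div_iff₀ hp]; exact h1
    · refine mul_nonneg ?_ (by linarith [hw.1])
      rw [sub_nonneg, div_le_iff₀ hp]; exact h1
  have e : b * (Real.log p + (w - p) / p - (w - p) ^ 2 / (2 * ((1 + δ) / l) ^ 2))
      = b * Real.log p + b / p * (w - p) - b / ((1 + δ) / l) ^ 2 / 2 * (w - p) ^ 2 := by
    field_simp
  rw [e] at hlog
  nlinarith

/-- The error of a mean utility is controlled by the error of the multiplier. -/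
theorem sq_sub_le_sq_daMultiplier_sub {l h δ b b₀ u uₛ V : ℝ} (hl : 0 < l) (hlh : l ≤ h)
    (hδ : 0 < δ) (hb₀ : 0 < b₀) (hb₀b : b₀ ≤ b) (hb1 : b ≤ 1) (hu : 0 ≤ u) (huV : u ≤ V)
    (huₛ : b * l ≤ uₛ) (huₛh : uₛ ≤ h) (huₛV : uₛ ≤ V) :
    (u - uₛ) ^ 2 ≤ (1 + δ) ^ 2 / b₀ ^ 2 * (h ^ 3 * V ^ 2 / l * (1 / δ) ^ 2 + h ^ 4)
      * (daMultiplier l h δ b u - b / uₛ) ^ 2 := by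
  have hh : 0 < h := hl.trans_le hlh
  have hb : 0 < b := hb₀.trans_le hb₀b
  have huₛ0 : 0 < uₛ := (mul_pos hb hl).trans_le huₛ
  have hac : b / (h * (1 + δ)) ≤ (1 + δ) / l := by
    rw [div_le_div_iff₀ (by positivity) hl]
    nlinarith [mul_pos hh hδ, mul_pos (mul_pos hh hδ) hδ]
  have hβ : b / h ≤ b / uₛ := by gcongr
  have hβ' : b / uₛ ≤ 1 / l := by rw [div_le_div_iff₀ huₛ0 hl]; linarith
  have hmem := daMultiplier_mem (u := u) hac
  have hV : (u - uₛ) ^ 2 ≤ V ^ 2 := sq_le_sq' (by linarith) (by linarith)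
  have hrel : 1 ≤ (1 + δ) / b₀ := by rw [le_div_iff₀ hb₀]; linarith
  rcases daMultiplier_cases hb hu hac with ⟨hu', h1⟩ | ⟨h1, h2⟩ | ⟨h1, h2⟩
  · rw [h1]
    have e : u - uₛ = -(u * uₛ / b) * (b / u - b / uₛ) := by field_simp; ring
    -- Without truncation from below `u` is bounded, so inverting `y ↦ b / y` is Lipschitz with
    -- constant `u uₛ / b`.
    have hub : u ≤ h * (1 + δ) := by
      have := hmem.1
      rw [h1, div_le_div_iff₀ (by positivity) hu'] at this
      exact le_of_mul_le_mul_left this hb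
    have hcoef : u * uₛ / b ≤ (1 + δ) / b₀ * h ^ 2 := by
      calc u * uₛ / b ≤ (h * (1 + δ)) * h / b₀ := by gcongr
        _ = _ := by ring
    calc (u - uₛ) ^ 2 = (u * uₛ / b) ^ 2 * (b / u - b / uₛ) ^ 2 := by
          conv_lhs => rw [e]
          ring
      _ ≤ ((1 + δ) / b₀ * h ^ 2) ^ 2 * (b / u - b / uₛ) ^ 2 := by gcongr
      _ = (1 + δ) ^ 2 / b₀ ^ 2 * h ^ 4 * (b / u - b / uₛ) ^ 2 := by ring
      _ ≤ _ := by
          gcongr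
          have : 0 ≤ h ^ 3 * V ^ 2 / l * (1 / δ) ^ 2 := by positivity
          linarith
  · rw [h2]
    -- When truncated, the multiplier stays a fixed distance from `b / uₛ ∈ [b/h, 1/l]`: this is the
    -- purpose of the margin `δ`. The trivial bound `V ^ 2` on the error then suffices. The factor
    -- `(h/l) ^ 3` below, and `h/l` in the last case, only bring both cases to one constant.
    have hgap : (δ / l) ^ 2 ≤ ((1 + δ) / l - b / uₛ) ^ 2 := by
      gcongr
      have : (1 + δ) / l = 1 / l + δ / l := by ring
      linarith
    have h3 : 1 ≤ (1 + δ) ^ 2 / b₀ ^ 2 := by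
      rw [← div_pow]; exact one_le_pow₀ hrel
    have h4 : 1 ≤ (h / l) ^ 3 := one_le_pow₀ (by rw [le_div_iff₀ hl]; linarith)
    calc (u - uₛ) ^ 2 ≤ 1 * (1 * V ^ 2) := by linarith
      _ ≤ (1 + δ) ^ 2 / b₀ ^ 2 * ((h / l) ^ 3 * V ^ 2) := by gcongr
      _ = (1 + δ) ^ 2 / b₀ ^ 2 * (h ^ 3 * V ^ 2 / l * (1 / δ) ^ 2) * (δ / l) ^ 2 := by
          field_simp
      _ ≤ _ := by
          gcongr
          have : 0 ≤ h ^ 4 := by positivity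
          linarith
  · rw [h2]
    have hgap : (b₀ * δ / (h * (1 + δ))) ^ 2 ≤ (b / (h * (1 + δ)) - b / uₛ) ^ 2 := by
      rw [← neg_sq (b / (h * (1 + δ)) - b / uₛ)]
      have h5 : b / h = b / (h * (1 + δ)) + b * δ / (h * (1 + δ)) := by field_simp
      have h6 : b₀ * δ / (h * (1 + δ)) ≤ b * δ / (h * (1 + δ)) := by gcongr
      gcongr
      linarith
    have h4 : 1 ≤ h / l := by rw [le_div_iff₀ hl]; linarith
    calc (u - uₛ) ^ 2 ≤ 1 * V ^ 2 := by linarith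
      _ ≤ h / l * V ^ 2 := by gcongr
      _ = (1 + δ) ^ 2 / b₀ ^ 2 * (h ^ 3 * V ^ 2 / l * (1 / δ) ^ 2)
            * (b₀ * δ / (h * (1 + δ))) ^ 2 := by
          field_simp
      _ ≤ _ := by
          gcongr
          have : 0 ≤ h ^ 4 := by positivity
          linarith

/-! ### The deterministic regret bound -/

/-- Weights of the squared gradients in the regret bound of dual averaging. -/
noncomputable def regretWeight (k : ℕ) : ℝ := if k = 0 then 2 else 1 / k

theorem regretWeight_nonneg (k : ℕ) : 0 ≤ regretWeight k := by
  unfold regretWeight; split_ifs <;> positivity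

/-- The weights are `2, 1, 1/2, 1/3, …`, so the sum is `2` plus the harmonic number of `T - 1`. -/
theorem sum_regretWeight_le {T : ℕ} (hT : 1 ≤ T) :
    ∑ k ∈ Finset.range T, regretWeight k ≤ 3 + Real.log T := by
  obtain ⟨N, rfl⟩ := Nat.exists_eq_add_of_le' hT
  rw [Finset.sum_range_succ']
  have h1 : ∑ k ∈ Finset.range N, regretWeight (k + 1) = ((harmonic N : ℚ) : ℝ) := by
    simp [regretWeight, harmonic]
  have h2 : Real.log N ≤ Real.log ((N + 1 : ℕ) : ℝ) := by
    rcases N.eq_zero_or_pos with rfl | hN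
    · simp
    · exact Real.log_le_log (by exact_mod_cast hN) (by push_cast; linarith)
  have h3 := harmonic_le_one_add_log N
  rw [h1]
  simp only [regretWeight, if_true]
  linarith

/-- Regret bound of scalar dual averaging with the logarithmic regulariser. -/
theorem dualAveraging_regret {a c b σ : ℝ} (hσ : 0 < σ) {g u p : ℕ → ℝ}
    (hu0 : u 0 = 0) (hu : ∀ k : ℕ, (k + 1 : ℝ) * u (k + 1) = k * u k + g k)
    (hp : ∀ k, p k ∈ Set.Icc a c)
    (hmin : ∀ k, ∀ w ∈ Set.Icc a c,
      u k * p k - b * Real.log (p k) + σ / 2 * (w - p k) ^ 2 ≤ u k * w - b * Real.log w)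
    {w : ℝ} (hw : w ∈ Set.Icc a c) (T : ℕ) :
    T * (σ / 2) * (p T - w) ^ 2 ≤
      ∑ k ∈ Finset.range T, (g k * (w - p k) + b * (Real.log (p k) - Real.log w))
        + ∑ k ∈ Finset.range T, g k ^ 2 * regretWeight k / (2 * σ) := by
  have hsum : ∀ N : ℕ, N * u N = ∑ k ∈ Finset.range N, g k := by
    intro N
    induction N with
    | zero => simp
    | succ k ih => rw [Finset.sum_range_succ, ← ih, ← hu k]; push_cast; ring
  have step : ∀ k : ℕ, -(g k ^ 2 * regretWeight k / (2 * σ)) ≤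
      k * (σ / 2) * (p (k + 1) - p k) ^ 2 + g k * (p (k + 1) - p k) := by
    intro k
    rcases k.eq_zero_or_pos with rfl | hk
    -- At `k = 0` the curvature term carries the factor `0`. Comparing the optimality of `p 0` and
    -- `p 1` bounds the move instead, at the cost of the weight `2`.
    · have h1 := hmin 0 (p 1) (hp 1)
      have h2 := hmin 1 (p 0) (hp 0)
      have h3 := hu 0
      simp only [Nat.cast_zero, zero_add, zero_mul, one_mul] at h3
      rw [hu0] at h1
      rw [h3] at h2
      have h4 : σ * (p 0 - p 1) ^ 2 ≤ g 0 * (p 0 - p 1) := by nlinarith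
      have h5 : g 0 * (p 0 - p 1) ≤ g 0 ^ 2 / σ := by
        rw [le_div_iff₀ hσ]
        nlinarith [sq_nonneg (g 0 - σ * (p 0 - p 1)), mul_le_mul_of_nonneg_left h4 hσ.le]
      simp only [regretWeight, if_true, Nat.cast_zero, zero_mul, zero_add]
      have h6 : g 0 ^ 2 * 2 / (2 * σ) = g 0 ^ 2 / σ := by field_simp
      rw [h6]; linarith
    · have hk' : (0 : ℝ) < k := by exact_mod_cast hk
      rw [regretWeight, if_neg hk.ne']
      have h1 : k * (σ / 2) * (p (k + 1) - p k) ^ 2 + g k * (p (k + 1) - p k)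
          = (k * σ * (p (k + 1) - p k) + g k) ^ 2 / (2 * k * σ)
            - g k ^ 2 * (1 / k) / (2 * σ) := by
        field_simp; ring
      have h2 : 0 ≤ (k * σ * (p (k + 1) - p k) + g k) ^ 2 / (2 * k * σ) := by positivity
      linarith
  -- The regulariser is charged at `p k` in round `k` rather than at `p (k + 1)`; the discrepancy
  -- telescopes to the two logarithms on the right.
  have main : ∀ N : ℕ, ∑ k ∈ Finset.range N, (g k * p k - b * Real.log (p k))
      - ∑ k ∈ Finset.range N, g k ^ 2 * regretWeight k / (2 * σ)
      ≤ N * (u N * p N - b * Real.log (p N)) + b * Real.log (p N) - b * Real.log (p 0) := by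
    intro N
    induction N with
    | zero => simp
    | succ k ih =>
      rw [Finset.sum_range_succ, Finset.sum_range_succ]
      have h1 := mul_le_mul_of_nonneg_left (hmin k _ (hp (k + 1))) (Nat.cast_nonneg (α := ℝ) k)
      have h2 := step k
      have h3 : (k + 1) * u (k + 1) * p (k + 1) = (k * u k + g k) * p (k + 1) := by rw [hu k]
      push_cast
      nlinarith
  have h1 := main T
  have h2 := mul_le_mul_of_nonneg_left (hmin T w hw) (Nat.cast_nonneg (α := ℝ) T)
  -- As `u 0 = 0`, the point `p 0` maximises `b log` over the box, so the telescoped logarithms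
  -- contribute at most `0`.
  have h3 := hmin 0 (p T) (hp T)
  rw [hu0] at h3
  have h4 : 0 ≤ σ / 2 * (p T - p 0) ^ 2 := by positivity
  have h5 : ∑ k ∈ Finset.range T, (g k * (w - p k) + b * (Real.log (p k) - Real.log w))
      = T * u T * w - T * (b * Real.log w)
        - ∑ k ∈ Finset.range T, (g k * p k - b * Real.log (p k)) := by
    rw [hsum, Finset.sum_mul]
    simp only [mul_sub, Finset.sum_add_distrib, Finset.sum_sub_distrib, Finset.sum_const,
      Finset.card_range, nsmul_eq_mul]
    ring
  rw [h5]
  nlinarith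

/-! ### Optimality conditions of the Eisenberg-Gale program -/

section EisenbergGale

variable {n m : ℕ} {B : Fin n → ℝ} {s : Fin m → ℝ} {v x y : Fin n → Fin m → ℝ}

theorem allocUtility_nonneg (hs : ∀ j, 0 ≤ s j) (hv : ∀ i j, 0 ≤ v i j) (hx : IsFeasible x)
    (i : Fin n) : 0 ≤ allocUtility s v x i :=
  Finset.sum_nonneg fun j _ => mul_nonneg (mul_nonneg (hs j) (hv i j)) (hx.1 i j)

theorem IsFeasible.le_one (hx : IsFeasible x) (i : Fin n) (j : Fin m) : x i j ≤ 1 :=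
  (Finset.single_le_sum (fun k _ => hx.1 k j) (Finset.mem_univ i)).trans (hx.2 j)

theorem allocUtility_le (hs : ∀ j, 0 ≤ s j) (hv : ∀ i j, 0 ≤ v i j) (hx : IsFeasible x)
    (i : Fin n) : allocUtility s v x i ≤ ∑ j, s j * v i j :=
  Finset.sum_le_sum fun j _ =>
    mul_le_of_le_one_right (mul_nonneg (hs j) (hv i j)) (hx.le_one i j)

theorem isFeasible_single (i : Fin n) :
    IsFeasible (fun k (_ : Fin m) => if k = i then (1 : ℝ) else 0) :=
  ⟨fun k _ => by beta_reduce; split_ifs <;> norm_num, fun _ => by simp⟩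

theorem isFeasible_convexComb {ε : ℝ} (hε : 0 ≤ ε) (hε1 : ε ≤ 1) (hx : IsFeasible x)
    (hy : IsFeasible y) : IsFeasible (fun i j => (1 - ε) * x i j + ε * y i j) := by
  refine ⟨fun i j => add_nonneg (mul_nonneg (by linarith) (hx.1 i j)) (mul_nonneg hε (hy.1 i j)),
    fun j => ?_⟩
  rw [Finset.sum_add_distrib, ← Finset.mul_sum, ← Finset.mul_sum]
  nlinarith [mul_le_mul_of_nonneg_left (hx.2 j) (sub_nonneg.2 hε1),
    mul_le_mul_of_nonneg_left (hy.2 j) hε]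

theorem allocUtility_convexComb (ε : ℝ) (i : Fin n) :
    allocUtility s v (fun i j => (1 - ε) * x i j + ε * y i j) i
      = (1 - ε) * allocUtility s v x i + ε * allocUtility s v y i := by
  simp only [allocUtility, Finset.mul_sum, ← Finset.sum_add_distrib]
  exact Finset.sum_congr rfl fun j _ => by ring

/-- A zero utility would make the welfare vanish, while the equal split has positive welfare. -/
theorem IsEGOptimal.allocUtility_pos (hB : ∀ i, 0 < B i) (hs : ∀ j, 0 ≤ s j)
    (hv : ∀ i j, 0 ≤ v i j) (hpos : ∀ i, 0 < ∑ j, s j * v i j) (hx : IsEGOptimal B s v x)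
    (i : Fin n) : 0 < allocUtility s v x i := by
  refine (allocUtility_nonneg hs hv hx.1 i).lt_of_ne fun h0 => ?_
  have hn : (0 : ℝ) < n := by exact_mod_cast i.pos
  have hfeas : IsFeasible (fun (_ : Fin n) (_ : Fin m) => 1 / (n : ℝ)) :=
    ⟨fun _ _ => by positivity, fun _ => by simp [hn.ne']⟩
  have hzero : nashWelfare B s v x = 0 :=
    Finset.prod_eq_zero (Finset.mem_univ i) (by rw [← h0, Real.zero_rpow (hB i).ne'])
  have hgt : 0 < nashWelfare B s v (fun _ _ => 1 / (n : ℝ)) := by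
    refine Finset.prod_pos fun k _ => Real.rpow_pos_of_pos ?_ _
    simp only [allocUtility, ← Finset.sum_mul]
    exact mul_pos (hpos k) (by positivity)
  linarith [hx.2 _ hfeas]

/-- First-order optimality: at the optimal prices no feasible allocation is worth more than the
total budget. -/
theorem IsEGOptimal.sum_div_mul_le_one (hB : ∀ i, 0 < B i) (hBsum : ∑ i, B i = 1)
    (hs : ∀ j, 0 ≤ s j) (hv : ∀ i j, 0 ≤ v i j) (hpos : ∀ i, 0 < ∑ j, s j * v i j)
    (hx : IsEGOptimal B s v x) (hy : IsFeasible y) :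
    ∑ i, B i / allocUtility s v x i * allocUtility s v y i ≤ 1 := by
  have hu := hx.allocUtility_pos hB hs hv hpos
  have hw := allocUtility_nonneg hs hv hy
  set u := allocUtility s v x
  set w := allocUtility s v y
  have hrpos : ∀ ε ∈ Set.Ioo (0 : ℝ) 1, ∀ i, 0 < 1 + ε * (w i / u i - 1) := by
    intro ε hε i
    have : 0 ≤ ε * (w i / u i) := mul_nonneg hε.1.le (div_nonneg (hw i) (hu i).le)
    linarith [hε.2]
  -- Moving from `x` towards `y` by `ε` cannot raise the log-welfare. The bound `log z ≥ 1 - 1/z`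
  -- makes this a rational inequality; dividing by `ε` and letting `ε → 0` gives the claim.
  have hfirst : ∀ ε ∈ Set.Ioo (0 : ℝ) 1,
      ∑ i, B i * ((w i / u i - 1) / (1 + ε * (w i / u i - 1))) ≤ 0 := by
    intro ε hε
    have hmix : ∀ i, (1 - ε) * u i + ε * w i = u i * (1 + ε * (w i / u i - 1)) := by
      intro i
      have := (hu i).ne'
      field_simp
      ring
    have h1 := hx.2 _ (isFeasible_convexComb hε.1.le hε.2.le hx.1 hy)
    have h2 : nashWelfare B s v (fun i j => (1 - ε) * x i j + ε * y i j)
        = nashWelfare B s v x * ∏ i, (1 + ε * (w i / u i - 1)) ^ B i := by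
      simp only [nashWelfare, allocUtility_convexComb, ← Finset.prod_mul_distrib]
      refine Finset.prod_congr rfl fun i _ => ?_
      rw [← Real.mul_rpow (hu i).le (hrpos ε hε i).le, ← hmix]
    have hN : 0 < nashWelfare B s v x :=
      Finset.prod_pos fun i _ => Real.rpow_pos_of_pos (hu i) _
    rw [h2] at h1
    have h3 : ∏ i, (1 + ε * (w i / u i - 1)) ^ B i ≤ 1 :=
      le_of_mul_le_mul_left (by rwa [mul_one]) hN
    have h4 := Real.log_nonpos
      (Finset.prod_nonneg fun i _ => Real.rpow_nonneg (hrpos ε hε i).le _) h3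
    rw [Real.log_prod fun i _ => (Real.rpow_pos_of_pos (hrpos ε hε i) _).ne'] at h4
    have h5 : ε * ∑ i, B i * ((w i / u i - 1) / (1 + ε * (w i / u i - 1))) ≤ 0 := by
      refine le_trans ?_ h4
      rw [Finset.mul_sum]
      refine Finset.sum_le_sum fun i _ => ?_
      rw [Real.log_rpow (hrpos ε hε i)]
      have h6 := mul_le_mul_of_nonneg_left
        (Real.one_sub_inv_le_log_of_pos (hrpos ε hε i)) (hB i).le
      refine le_of_eq_of_le ?_ h6
      have := (hrpos ε hε i).ne'
      field_simp
      ring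
    by_contra hcon
    exact absurd h5 (not_le.2 (mul_pos hε.1 (not_le.1 hcon)))
  have hlim : Filter.Tendsto
      (fun ε : ℝ => ∑ i, B i * ((w i / u i - 1) / (1 + ε * (w i / u i - 1))))
      (nhdsWithin 0 (Set.Ioi 0))
      (nhds (∑ i, B i * ((w i / u i - 1) / (1 + 0 * (w i / u i - 1))))) := by
    refine Filter.Tendsto.mono_left ?_ nhdsWithin_le_nhds
    refine tendsto_finsetSum _ fun i _ => ?_
    refine Filter.Tendsto.const_mul _ (Filter.Tendsto.div tendsto_const_nhds ?_ (by simp))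
    exact (Filter.tendsto_id.mul_const _).const_add _
  have h0 := le_of_tendsto hlim (by
    filter_upwards [Ioo_mem_nhdsGT (zero_lt_one (α := ℝ))] with ε hε using hfirst ε hε)
  have e : ∑ i, B i * ((w i / u i - 1) / (1 + 0 * (w i / u i - 1)))
      = ∑ i, B i / u i * w i - 1 := by
    conv_rhs => rw [← hBsum, ← Finset.sum_sub_distrib]
    refine Finset.sum_congr rfl fun i _ => ?_
    rw [zero_mul, add_zero, div_one]
    ring
  linarith

/-- Test the first-order condition with the allocation that gives everything to `i`. It yields `B i
/ uₛ i ≤ 1 / l`, so the optimal multiplier respects the upper truncation. -/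
theorem IsEGOptimal.mul_le_allocUtility (hB : ∀ i, 0 < B i) (hBsum : ∑ i, B i = 1)
    (hs : ∀ j, 0 ≤ s j) (hv : ∀ i j, 0 ≤ v i j) {l : ℝ} (hl : 0 < l)
    (hlv : ∀ i, l ≤ ∑ j, s j * v i j) (hx : IsEGOptimal B s v x) (i : Fin n) :
    B i * l ≤ allocUtility s v x i := by
  have hpos := fun k => hl.trans_le (hlv k)
  have hu := hx.allocUtility_pos hB hs hv hpos
  have h := hx.sum_div_mul_le_one hB hBsum hs hv hpos (isFeasible_single i)
  have hi := (Finset.single_le_sum (fun k _ => mul_nonneg (div_nonneg (hB k).le (hu k).le)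
    (allocUtility_nonneg hs hv (isFeasible_single i) k)) (Finset.mem_univ i)).trans h
  have e : allocUtility s v (fun k _ => if k = i then 1 else 0) i = ∑ j, s j * v i j := by
    simp [allocUtility]
  rw [e, div_mul_eq_mul_div, div_le_one (hu i)] at hi
  exact (mul_le_mul_of_nonneg_left (hlv i) (hB i).le).trans hi

/-- The optimal multipliers are dual feasible: the expected highest bid is at most `1`. -/
theorem IsEGOptimal.sum_mul_bid_le_one (hB : ∀ i, 0 < B i) (hBsum : ∑ i, B i = 1)
    (hs : ∀ j, 0 ≤ s j) (hv : ∀ i j, 0 ≤ v i j) (hpos : ∀ i, 0 < ∑ j, s j * v i j)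
    (hx : IsEGOptimal B s v x) (k : Fin m → Fin n) :
    ∑ j, s j * (B (k j) / allocUtility s v x (k j) * v (k j) j) ≤ 1 := by
  have hf : IsFeasible (fun i j => if i = k j then (1 : ℝ) else 0) :=
    ⟨fun i j => by beta_reduce; split_ifs <;> norm_num, fun j => by simp⟩
  refine le_of_eq_of_le ?_ (hx.sum_div_mul_le_one hB hBsum hs hv hpos hf)
  simp only [allocUtility, Finset.mul_sum]
  rw [Finset.sum_comm]
  refine Finset.sum_congr rfl fun j _ => ?_
  simp only [mul_ite, mul_one, mul_zero, Finset.sum_ite_eq', Finset.mem_univ, if_true]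
  ring

end EisenbergGale

/-! ### Mean utilities -/

section MeanUtility

variable {n m : ℕ} {v : Fin n → Fin m → ℝ}

/-- The utility that agent `i` draws from an item of type `j` given to agent `k`. -/
noncomputable def gain {n m : ℕ} (v : Fin n → Fin m → ℝ) (j : Fin m) (k i : Fin n) : ℝ :=
  if i = k then v i j else 0

theorem gain_nonneg (hv : ∀ i j, 0 ≤ v i j) (j : Fin m) (k i : Fin n) : 0 ≤ gain v j k i := by
  unfold gain; split_ifs; exacts [hv i j, le_rfl]

theorem le_norm (i : Fin n) (j : Fin m) : v i j ≤ ‖v‖ :=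
  (le_abs_self _).trans ((norm_le_pi_norm (v i) j).trans (norm_le_pi_norm v i))

theorem gain_le_norm (j : Fin m) (k i : Fin n) : gain v j k i ≤ ‖v‖ := by
  unfold gain; split_ifs; exacts [le_norm i j, norm_nonneg v]

theorem sum_gain_mul (j : Fin m) (k : Fin n) (f : Fin n → ℝ) :
    ∑ i, gain v j k i * f i = v k j * f k := by
  simp [gain]

theorem sum_gain_sq_le (hv : ∀ i j, 0 ≤ v i j) (j : Fin m) (k : Fin n) :
    ∑ i, gain v j k i ^ 2 ≤ ‖v‖ ^ 2 := by
  have : ∑ i, gain v j k i ^ 2 = v k j ^ 2 := by simp [gain]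
  rw [this]
  exact pow_le_pow_left₀ (hv k j) (le_norm k j) 2

theorem succ_mul_meanUtility_succ (item : ℕ → Fin m) (winner : ℕ → Fin n) (t : ℕ) (i : Fin n) :
    (t + 1 : ℝ) * meanUtility v item winner (t + 1) i
      = t * meanUtility v item winner t i + gain v (item t) (winner t) i := by
  simp only [meanUtility, gain]
  field_simp

theorem mul_meanUtility (item : ℕ → Fin m) (winner : ℕ → Fin n) (t : ℕ) (i : Fin n) :
    t * meanUtility v item winner t i
      = ∑ k : Fin t, gain v (item k) (winner k) i := by
  induction t with
  | zero => simp
  | succ t ih =>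
    rw [Fin.sum_univ_castSucc, Nat.cast_succ, succ_mul_meanUtility_succ, ih]
    simp

theorem meanUtility_eq (item : ℕ → Fin m) (winner : ℕ → Fin n) (t : ℕ) (i : Fin n) :
    meanUtility v item winner t i
      = 1 / t * ∑ k : Fin t, gain v (item k) (winner k) i := by
  rcases t.eq_zero_or_pos with rfl | ht
  · simp [meanUtility]
  · have : (t : ℝ) ≠ 0 := by exact_mod_cast ht.ne'
    rw [← mul_meanUtility]
    field_simp

theorem meanUtility_nonneg (hv : ∀ i j, 0 ≤ v i j) (item : ℕ → Fin m) (winner : ℕ → Fin n)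
    (t : ℕ) (i : Fin n) : 0 ≤ meanUtility v item winner t i := by
  rw [meanUtility_eq]
  exact mul_nonneg (by positivity) (Finset.sum_nonneg fun k _ => gain_nonneg hv _ _ i)

theorem meanUtility_le_norm (item : ℕ → Fin m) (winner : ℕ → Fin n)
    (t : ℕ) (i : Fin n) : meanUtility v item winner t i ≤ ‖v‖ := by
  rcases t.eq_zero_or_pos with rfl | ht
  · simp [meanUtility]
  · have ht' : (0 : ℝ) < t := by exact_mod_cast ht
    refine le_of_mul_le_mul_left ?_ ht'
    rw [mul_meanUtility]
    refine (Finset.sum_le_sum fun k _ => gain_le_norm _ _ i).trans ?_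
    simp

end MeanUtility

/-! ### Expectations of functions of the history -/

section Expectation

variable {Ω : Type*} [MeasurableSpace Ω] {μ : Measure Ω} [IsProbabilityMeasure μ]

theorem integrable_comp_of_finite {α : Type*} [MeasurableSpace α] [Finite α]
    [MeasurableSingletonClass α] {X : Ω → α} (hX : Measurable X) (f : α → ℝ) :
    Integrable (fun ω => f (X ω)) μ := by
  have : IsProbabilityMeasure (μ.map X) := Measure.isProbabilityMeasure_map hX.aemeasurable
  have h : Integrable f (μ.map X) := Integrable.of_finite
  exact h.comp_measurable hX

theorem integral_comp_eq_sum {m : ℕ} {s : Fin m → ℝ} {X : Ω → Fin m} (hX : Measurable X)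
    (hlaw : ∀ j, μ.real {ω | X ω = j} = s j) (f : Fin m → ℝ) :
    ∫ ω, f (X ω) ∂μ = ∑ j, s j * f j := by
  have : IsProbabilityMeasure (μ.map X) := Measure.isProbabilityMeasure_map hX.aemeasurable
  have h : Integrable f (μ.map X) := Integrable.of_finite
  rw [← integral_map hX.aemeasurable h.1, integral_fintype h]
  refine Finset.sum_congr rfl fun j _ => ?_
  rw [map_measureReal_apply hX (measurableSet_singleton j), ← hlaw j, smul_eq_mul]
  rfl

end Expectation

section Run

variable {Ω : Type*} [MeasurableSpace Ω] {μ : Measure Ω} {n m T : ℕ}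
  {B : Fin n → ℝ} {s : Fin m → ℝ} {v : Fin n → Fin m → ℝ} {l h δ₀ : ℝ}
  {item : ℕ → Ω → Fin m} {winner : ℕ → Ω → Fin n}

theorem IsDARun.measurable_history (hrun : IsDARun μ T B s v l h δ₀ item winner) {t : ℕ}
    (ht : t ≤ T) : Measurable (fun ω => fun k : Fin t => (item k ω, winner k ω)) :=
  measurable_pi_lambda _ fun k =>
    (hrun.measurable_item k (k.2.trans_le ht)).prodMk (hrun.measurable_winner k (k.2.trans_le ht))

/-- The mean utility of agent `i` as a function of the history. -/
noncomputable def historyUtility {n m : ℕ} (v : Fin n → Fin m → ℝ) {t : ℕ}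
    (H : Fin t → Fin m × Fin n) (i : Fin n) : ℝ :=
  1 / t * ∑ k, gain v (H k).1 (H k).2 i

/-- The history takes finitely many values, so `f` needs no measurability. -/
theorem IsDARun.integrable_history (hrun : IsDARun μ T B s v l h δ₀ item winner)
    [IsProbabilityMeasure μ] {t : ℕ} (ht : t ≤ T) (f : (Fin n → ℝ) → ℝ) :
    Integrable (fun ω => f (meanUtility v (fun k => item k ω) (fun k => winner k ω) t)) μ := by
  have h1 := integrable_comp_of_finite (μ := μ) (hrun.measurable_history ht)
    (fun H => f (historyUtility v H))
  refine h1.congr (Filter.Eventually.of_forall fun ω => congrArg f (funext fun i => ?_))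
  exact (meanUtility_eq (fun k => item k ω) (fun k => winner k ω) t i).symm

/-- Multipliers in round `t` depend only on earlier rounds, hence are independent of the current
item and the expectation factors. -/
theorem IsDARun.integral_item_mul_history (hrun : IsDARun μ T B s v l h δ₀ item winner)
    [IsProbabilityMeasure μ] {t : ℕ} (ht : t < T) (a : Fin m → ℝ) (f : (Fin n → ℝ) → ℝ) :
    Integrable (fun ω => a (item t ω)
      * f (meanUtility v (fun k => item k ω) (fun k => winner k ω) t)) μ ∧
    ∫ ω, a (item t ω) * f (meanUtility v (fun k => item k ω) (fun k => winner k ω) t) ∂μ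
      = (∑ j, s j * a j)
        * ∫ ω, f (meanUtility v (fun k => item k ω) (fun k => winner k ω) t) ∂μ := by
  have hitem := hrun.measurable_item t ht
  have hfun : ∀ ω, historyUtility v (fun k : Fin t => (item k ω, winner k ω))
      = meanUtility v (fun k => item k ω) (fun k => winner k ω) t :=
    fun ω => funext fun i =>
      (meanUtility_eq (fun k => item k ω) (fun k => winner k ω) t i).symm
  have hind := (hrun.nonanticipating t ht).comp (φ := a) (ψ := fun H => f (historyUtility v H))
    (measurable_of_finite _) (measurable_of_finite _)
  have hind' : IndepFun (fun ω => a (item t ω))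
      (fun ω => f (meanUtility v (fun k => item k ω) (fun k => winner k ω) t)) μ := by
    simpa only [Function.comp_def, hfun] using hind
  have hia := integrable_comp_of_finite (μ := μ) hitem a
  have hif := hrun.integrable_history ht.le f
  refine ⟨hind'.integrable_mul hia hif, ?_⟩
  rw [hind'.integral_fun_mul_eq_mul_integral hia.1 hif.1,
    integral_comp_eq_sum hitem (hrun.law_item t ht) a]

end Run

/-! ### Convergence of dual averaging -/

section Convergence

variable {n m T : ℕ} {B : Fin n → ℝ} {s : Fin m → ℝ} {v x : Fin n → Fin m → ℝ} {l h δ₀ : ℝ}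

/-- Pathwise bound on the distance of the multipliers from the dual vector `B / uₛ`. -/
theorem sum_sq_daMultiplier_sub_le (hT : 1 ≤ T) (hB : ∀ i, 0 < B i) (hBsum : ∑ i, B i = 1)
    (hv : ∀ i j, 0 ≤ v i j) (hl : 0 < l) (hlh : l ≤ h) (hδ : 0 < δ₀)
    {item : ℕ → Fin m} {winner : ℕ → Fin n} {p : ℕ → Fin n → ℝ}
    (hp : ∀ t i, p t i = daMultiplier l h δ₀ (B i) (meanUtility v item winner t i))
    (hmax : ∀ t < T, ∀ i,
      p t i * v i (item t) ≤ p t (winner t) * v (winner t) (item t))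
    (hx : IsFeasible x) {uₛ : Fin n → ℝ} (huₛ : ∀ i, B i * l ≤ uₛ i) (huₛh : ∀ i, uₛ i ≤ h)
    {k : Fin m → Fin n} (hk : ∀ i j, B i / uₛ i * v i j ≤ B (k j) / uₛ (k j) * v (k j) j)
    {b₀ : ℝ} (hb₀ : 0 < b₀) (hb₀B : ∀ i, b₀ ≤ B i) :
    T * (b₀ / ((1 + δ₀) / l) ^ 2 / 2) * ∑ i, (p T i - B i / uₛ i) ^ 2 ≤
      ∑ t ∈ Finset.range T, (B (k (item t)) / uₛ (k (item t)) * v (k (item t)) (item t) - 1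
        + ∑ i, (uₛ i - v i (item t) * x i (item t)) * p t i)
      + ‖v‖ ^ 2 * (3 + Real.log T) / (2 * (b₀ / ((1 + δ₀) / l) ^ 2)) := by
  have hh : 0 < h := hl.trans_le hlh
  have hB1 : ∀ i, B i ≤ 1 := fun i =>
    hBsum ▸ Finset.single_le_sum (fun k _ => (hB k).le) (Finset.mem_univ i)
  have hu0 : ∀ i, 0 < uₛ i := fun i => (mul_pos (hB i) hl).trans_le (huₛ i)
  have hac : ∀ i, B i / (h * (1 + δ₀)) ≤ (1 + δ₀) / l := by
    intro i
    rw [div_le_div_iff₀ (by positivity) hl]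
    nlinarith [mul_pos hh hδ, mul_pos (mul_pos hh hδ) hδ, hB1 i, hB i]
  have hmem : ∀ t i, p t i ∈ Set.Icc (B i / (h * (1 + δ₀))) ((1 + δ₀) / l) := fun t i => by
    rw [hp]; exact daMultiplier_mem (hac i)
  have hppos : ∀ t i, 0 < p t i := fun t i =>
    lt_of_lt_of_le (div_pos (hB i) (by positivity)) (hmem t i).1
  have hwmem : ∀ i, B i / uₛ i ∈ Set.Icc (B i / (h * (1 + δ₀))) ((1 + δ₀) / l) := by
    intro i
    constructor
    · refine div_le_div_of_nonneg_left (hB i).le (hu0 i) ((huₛh i).trans ?_)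
      nlinarith
    · rw [div_le_div_iff₀ (hu0 i) hl]
      nlinarith [huₛ i, hu0 i]
  set σ := b₀ / ((1 + δ₀) / l) ^ 2 with hσ
  have hσ0 : 0 < σ := by positivity
  -- One modulus of strong convexity serves all agents; the smallest budget dictates it.
  have hσB : ∀ i, σ ≤ B i / ((1 + δ₀) / l) ^ 2 := fun i =>
    div_le_div_of_nonneg_right (hb₀B i) (by positivity)
  have hreg : ∀ i, T * (σ / 2) * (p T i - B i / uₛ i) ^ 2 ≤
      ∑ t ∈ Finset.range T, (gain v (item t) (winner t) i * (B i / uₛ i - p t i)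
        + (uₛ i * p t i - B i))
      + ∑ t ∈ Finset.range T, gain v (item t) (winner t) i ^ 2 * regretWeight t / (2 * σ) := by
    intro i
    refine (dualAveraging_regret (b := B i) hσ0 (u := fun t => meanUtility v item winner t i) rfl
      (fun t => succ_mul_meanUtility_succ item winner t i) (fun t => hmem t i) (fun t w hw => ?_)
      (hwmem i) T).trans ?_
    · have h1 := daMultiplier_isMin hl hh hδ (hB i) (meanUtility_nonneg hv item winner t i)
        (hac i) hw
      rw [← hp] at h1
      have h2 := mul_le_mul_of_nonneg_right (hσB i) (sq_nonneg (w - p t i))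
      linarith
    · gcongr with t
      have hw0 : 0 < B i / uₛ i := div_pos (hB i) (hu0 i)
      -- With `w = B i / uₛ i`, the bound `log (p/w) ≤ p/w - 1` linearises the regulariser to `uₛ i
      -- * p - B i`, whose expectation can be computed later.
      rw [← Real.log_div (hppos t i).ne' hw0.ne']
      have h1 := mul_le_mul_of_nonneg_left
        (Real.log_le_sub_one_of_pos (div_pos (hppos t i) hw0)) (hB i).le
      refine h1.trans_eq ?_
      have := (hB i).ne'
      field_simp
  rw [Finset.mul_sum]
  refine (Finset.sum_le_sum fun i _ => hreg i).trans ?_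
  rw [Finset.sum_add_distrib, Finset.sum_comm, Finset.sum_comm (s := Finset.univ)]
  refine add_le_add (Finset.sum_le_sum fun t ht => ?_) ?_
  · have h1 : ∑ i, (gain v (item t) (winner t) i * (B i / uₛ i - p t i) + (uₛ i * p t i - B i))
        = B (winner t) / uₛ (winner t) * v (winner t) (item t)
          - p t (winner t) * v (winner t) (item t) + ∑ i, uₛ i * p t i - 1 := by
      rw [Finset.sum_add_distrib, sum_gain_mul, Finset.sum_sub_distrib, hBsum]
      ring
    -- The highest bid is at least any subprobability average of the bids, here with weights `x i
    -- (item t)`.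
    have h2 : ∑ i, v i (item t) * x i (item t) * p t i
        ≤ p t (winner t) * v (winner t) (item t) := by
      calc ∑ i, v i (item t) * x i (item t) * p t i
          ≤ ∑ i, x i (item t) * (p t (winner t) * v (winner t) (item t)) := by
            refine Finset.sum_le_sum fun i _ => ?_
            have := mul_le_mul_of_nonneg_left (hmax t (Finset.mem_range.1 ht) i)
              (hx.1 i (item t))
            linarith
        _ = (∑ i, x i (item t)) * (p t (winner t) * v (winner t) (item t)) :=
            (Finset.sum_mul _ _ _).symm
        _ ≤ _ := mul_le_of_le_one_left (mul_nonneg (hppos t _).le (hv _ _)) (hx.2 _)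
    have h3 := hk (winner t) (item t)
    rw [h1]
    simp only [sub_mul, Finset.sum_sub_distrib]
    linarith
  · calc ∑ t ∈ Finset.range T, ∑ i,
          gain v (item t) (winner t) i ^ 2 * regretWeight t / (2 * σ)
        = ∑ t ∈ Finset.range T,
          (∑ i, gain v (item t) (winner t) i ^ 2) * (regretWeight t / (2 * σ)) := by
          simp only [Finset.sum_mul, mul_div_assoc]
      _ ≤ ∑ t ∈ Finset.range T, ‖v‖ ^ 2 * (regretWeight t / (2 * σ)) := by
          refine Finset.sum_le_sum fun t _ => mul_le_mul_of_nonneg_right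
            (sum_gain_sq_le hv _ _) (div_nonneg (regretWeight_nonneg t) (by positivity))
      _ = ‖v‖ ^ 2 * (∑ t ∈ Finset.range T, regretWeight t) / (2 * σ) := by
          rw [← Finset.mul_sum, ← Finset.sum_div, mul_div_assoc]
      _ ≤ _ := by
          have := sum_regretWeight_le hT
          gcongr

variable {Ω : Type*} [MeasurableSpace Ω] {μ : Measure Ω} [IsProbabilityMeasure μ]
  {item : ℕ → Ω → Fin m} {winner : ℕ → Ω → Fin n}

/-- Mean square convergence of the multipliers. -/
theorem IsDARun.integral_sum_sq_daMultiplier_sub_le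
    (hrun : IsDARun μ T B s v l h δ₀ item winner) (hT : 1 ≤ T) (hB : ∀ i, 0 < B i)
    (hBsum : ∑ i, B i = 1) (hs : ∀ j, 0 ≤ s j) (hv : ∀ i j, 0 ≤ v i j)
    (hl : 0 < l) (hlh : l ≤ h) (hδ : 0 < δ₀)
    (hlv : ∀ i, l ≤ ∑ j, s j * v i j) (hvh : ∀ i, ∑ j, s j * v i j ≤ h)
    (hx : IsEGOptimal B s v x) {b₀ : ℝ} (hb₀ : 0 < b₀) (hb₀B : ∀ i, b₀ ≤ B i) :
    ∫ ω, ∑ i, (daMultiplier l h δ₀ (B i)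
        (meanUtility v (fun k => item k ω) (fun k => winner k ω) T i)
          - B i / allocUtility s v x i) ^ 2 ∂μ
      ≤ ‖v‖ ^ 2 * (1 + δ₀) ^ 4 / (l ^ 4 * b₀ ^ 2) * ((3 + Real.log T) / T) := by
  have hpos := fun i => hl.trans_le (hlv i)
  have hne : Nonempty (Fin n) := by
    by_contra hcon
    rw [not_nonempty_iff] at hcon
    simp at hBsum
  set uₛ := allocUtility s v x with huₛ
  -- `k j` is a highest bidder for type `j` at the optimal multipliers.
  choose k hk using fun j : Fin m => Finite.exists_max fun i => B i / uₛ i * v i j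
  set p : Ω → ℕ → Fin n → ℝ := fun ω t i => daMultiplier l h δ₀ (B i)
    (meanUtility v (fun k => item k ω) (fun k => winner k ω) t i) with hp
  set M : Fin m → ℝ := fun j => B (k j) / uₛ (k j) * v (k j) j with hM
  set D : ℝ := ‖v‖ ^ 2 * (3 + Real.log T) / (2 * (b₀ / ((1 + δ₀) / l) ^ 2)) with hD
  have hpath : ∀ ω, T * (b₀ / ((1 + δ₀) / l) ^ 2 / 2) * ∑ i, (p ω T i - B i / uₛ i) ^ 2 ≤
      ∑ t ∈ Finset.range T, (M (item t ω) - 1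
        + ∑ i, (uₛ i - v i (item t ω) * x i (item t ω)) * p ω t i) + D := fun ω =>
    sum_sq_daMultiplier_sub_le hT hB hBsum hv hl hlh hδ (item := fun k => item k ω)
      (winner := fun k => winner k ω) (p := p ω) (fun _ _ => rfl)
      (fun t ht i => hrun.winner_maximal t ht ω i) hx.1
      (hx.mul_le_allocUtility hB hBsum hs hv hl hlv)
      (fun i => (allocUtility_le hs hv hx.1 i).trans (hvh i)) (fun i j => hk j i) hb₀ hb₀B
  have hMint : ∀ t < T, Integrable (fun ω => M (item t ω)) μ := fun t ht =>
    integrable_comp_of_finite (hrun.measurable_item t ht) M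
  have hprod := fun (t : ℕ) (ht : t < T) (i : Fin n) => hrun.integral_item_mul_history ht
    (fun j => uₛ i - v i j * x i j) (fun u => daMultiplier l h δ₀ (B i) (u i))
  have hssum : ∑ j, s j = 1 := by
    have h1 := integral_comp_eq_sum (hrun.measurable_item 0 hT) (hrun.law_item 0 hT) (fun _ => 1)
    simpa using h1.symm
  have hzero : ∀ i, ∑ j, s j * (uₛ i - v i j * x i j) = 0 := by
    intro i
    simp only [mul_sub, Finset.sum_sub_distrib, ← Finset.sum_mul, hssum, one_mul]
    rw [huₛ, allocUtility, sub_eq_zero]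
    exact Finset.sum_congr rfl fun j _ => mul_assoc _ _ _
  -- The terms with `p` have mean zero by independence and `hzero`; dual feasibility gives mean at
  -- most `1` for `M`.
  have hround : ∀ t < T, Integrable (fun ω => M (item t ω) - 1
        + ∑ i, (uₛ i - v i (item t ω) * x i (item t ω)) * p ω t i) μ ∧
      ∫ ω, (M (item t ω) - 1
        + ∑ i, (uₛ i - v i (item t ω) * x i (item t ω)) * p ω t i) ∂μ ≤ 0 := by
    intro t ht
    have hi1 : Integrable (fun ω => M (item t ω) - 1) μ := (hMint t ht).sub (integrable_const 1)
    have hi2 : Integrable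
        (fun ω => ∑ i, (uₛ i - v i (item t ω) * x i (item t ω)) * p ω t i) μ :=
      integrable_finsetSum _ fun i _ => (hprod t ht i).1
    refine ⟨hi1.add hi2, ?_⟩
    rw [integral_add hi1 hi2, integral_sub (hMint t ht) (integrable_const 1),
      integral_finsetSum _ fun i _ => (hprod t ht i).1]
    rw [Finset.sum_congr rfl fun i _ => (hprod t ht i).2]
    simp only [hzero, zero_mul, Finset.sum_const_zero, add_zero]
    rw [integral_comp_eq_sum (hrun.measurable_item t ht) (hrun.law_item t ht) M]
    have := hx.sum_mul_bid_le_one hB hBsum hs hv hpos k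
    simpa using this
  have hint : Integrable (fun ω => ∑ i, (p ω T i - B i / uₛ i) ^ 2) μ :=
    hrun.integrable_history le_rfl
      (fun u => ∑ i, (daMultiplier l h δ₀ (B i) (u i) - B i / uₛ i) ^ 2)
  have hrounds : Integrable (fun ω => ∑ t ∈ Finset.range T, (M (item t ω) - 1
        + ∑ i, (uₛ i - v i (item t ω) * x i (item t ω)) * p ω t i)) μ :=
    integrable_finsetSum _ fun t ht => (hround t (Finset.mem_range.1 ht)).1
  have hI := integral_mono (hint.const_mul _) (hrounds.add (integrable_const D)) hpath
  simp only [Pi.add_apply] at hI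
  rw [integral_const_mul, integral_add hrounds (integrable_const D),
    integral_finsetSum _ fun t ht => (hround t (Finset.mem_range.1 ht)).1] at hI
  have hneg := Finset.sum_nonpos fun t ht => (hround t (Finset.mem_range.1 ht)).2
  have hT0 : (0 : ℝ) < T := by exact_mod_cast hT
  have hfin : T * (b₀ / ((1 + δ₀) / l) ^ 2 / 2)
      * ∫ ω, ∑ i, (p ω T i - B i / uₛ i) ^ 2 ∂μ ≤ D := by
    refine hI.trans ?_
    simp only [integral_const, probReal_univ, smul_eq_mul, one_mul]
    linarith
  rw [mul_comm, ← le_div_iff₀ (by positivity)] at hfin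
  refine hfin.trans_eq ?_
  rw [hD]
  field_simp

end Convergence

end OnlineFairDivision

/-! ### Conclusion: from multipliers to mean utilities. -/

open OnlineFairDivision

theorem mainTheorem4 {Ω : Type*} [MeasurableSpace Ω] (μ : Measure Ω) [IsProbabilityMeasure μ]
    {n m : ℕ} (T : ℕ) (hT : 1 ≤ T)
    (B : Fin n → ℝ) (hB : ∀ i, 0 < B i) (hBsum : ∑ i, B i = 1)
    (s : Fin m → ℝ) (hs : ∀ j, 0 ≤ s j) (hssum : ∑ j, s j = 1)
    (v : Fin n → Fin m → ℝ) (hv : ∀ i j, 0 ≤ v i j)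
    (l h δ₀ : ℝ) (hl : 0 < l) (hδ₀ : 0 < δ₀)
    (hlv : ∀ i, l ≤ ∑ j, s j * v i j) (hvh : ∀ i, ∑ j, s j * v i j ≤ h)
    (item : ℕ → Ω → Fin m) (winner : ℕ → Ω → Fin n)
    (hrun : OnlineFairDivision.IsDARun μ T B s v l h δ₀ item winner)
    (uStar : Fin n → ℝ) (hu : OnlineFairDivision.IsEGUtility B s v uStar) :
    let sqErr : Ω → ℝ := fun ω =>
      ‖(WithLp.toLp 2 (fun i => OnlineFairDivision.meanUtility v (fun k => item k ω)
        (fun k => winner k ω) T i - uStar i) : EuclideanSpace ℝ (Fin n))‖ ^ 2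
    Integrable sqErr μ ∧
      ∫ ω, sqErr ω ∂μ
        ≤ OnlineFairDivision.daConstant B v l h δ₀ * ((6 + Real.log T) / T) := by
  intro sqErr
  obtain ⟨x, hx, rfl⟩ := hu
  have hne : Nonempty (Fin n) := by
    by_contra hcon
    rw [not_nonempty_iff] at hcon
    simp at hBsum
  have hlh : l ≤ h := (hlv hne.some).trans (hvh hne.some)
  obtain ⟨i₀, hi₀⟩ := exists_eq_ciInf_of_finite (f := B)
  have hb₀ : 0 < ⨅ i, B i := hi₀ ▸ hB i₀
  have hb₀B : ∀ i, ⨅ i, B i ≤ B i := fun i => ciInf_le (Set.finite_range B).bddBelow i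
  have hB1 : ∀ i, B i ≤ 1 := fun i =>
    hBsum ▸ Finset.single_le_sum (fun k _ => (hB k).le) (Finset.mem_univ i)
  have hbound := hrun.integral_sum_sq_daMultiplier_sub_le hT hB hBsum hs hv hl hlh hδ₀ hlv hvh
    hx hb₀ hb₀B
  set b₀ := ⨅ i, B i with hb₀def
  have hsqErr : sqErr = fun ω => ∑ i, (meanUtility v (fun k => item k ω)
      (fun k => winner k ω) T i - allocUtility s v x i) ^ 2 :=
    funext fun ω => EuclideanSpace.real_norm_sq_eq _
  have hint : Integrable sqErr μ := by
    rw [hsqErr]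
    exact hrun.integrable_history le_rfl (fun u => ∑ i, (u i - allocUtility s v x i) ^ 2)
  refine ⟨hint, ?_⟩
  have huV : ∀ i, allocUtility s v x i ≤ ‖v‖ := by
    intro i
    refine (allocUtility_le hs hv hx.1 i).trans ?_
    calc ∑ j, s j * v i j ≤ ∑ j, s j * ‖v‖ :=
          Finset.sum_le_sum fun j _ => mul_le_mul_of_nonneg_left (le_norm i j) (hs j)
      _ = ‖v‖ := by rw [← Finset.sum_mul, hssum, one_mul]
  set K := (1 + δ₀) ^ 2 / b₀ ^ 2 * (h ^ 3 * ‖v‖ ^ 2 / l * (1 / δ₀) ^ 2 + h ^ 4) with hK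
  have hh : 0 < h := hl.trans_le hlh
  have hK0 : 0 ≤ K := by positivity
  have hdist : Integrable (fun ω => ∑ i, (daMultiplier l h δ₀ (B i)
      (meanUtility v (fun k => item k ω) (fun k => winner k ω) T i)
        - B i / allocUtility s v x i) ^ 2) μ :=
    hrun.integrable_history le_rfl
      (fun u => ∑ i, (daMultiplier l h δ₀ (B i) (u i) - B i / allocUtility s v x i) ^ 2)
  have hle := integral_mono hint (hdist.const_mul K) fun ω => by
    simp only [hsqErr, Finset.mul_sum]
    exact Finset.sum_le_sum fun i _ => sq_sub_le_sq_daMultiplier_sub hl hlh hδ₀ hb₀ (hb₀B i)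
      (hB1 i) (meanUtility_nonneg hv _ _ T i) (meanUtility_le_norm _ _ T i)
      (hx.mul_le_allocUtility hB hBsum hs hv hl hlv i)
      ((allocUtility_le hs hv hx.1 i).trans (hvh i)) (huV i)
  rw [integral_const_mul] at hle
  have hT0 : (0 : ℝ) < T := by exact_mod_cast hT
  refine hle.trans ((mul_le_mul_of_nonneg_left hbound hK0).trans ?_)
  have hconst : daConstant B v l h δ₀ = K * (‖v‖ ^ 2 * (1 + δ₀) ^ 4 / (l ^ 4 * b₀ ^ 2)) := by
    rw [hK, daConstant, ← hb₀def]
    field_simp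
  rw [hconst, mul_assoc K]
  clear_value K
  -- The argument gives `3 + log T`; only `3 ≤ 6` remains.
  gcongr
  norm_num
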